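/- For integers $r,n,v,e$ let $f_r(n,v,e)$ denote the maximum number of edges in an $r$-uniform hypergraph on $n$ vertices (a family of distinct $r$-element subsets of an $n$-element set) in which the union of any $e$ distinct edges contains at least $v+1$ vertices, i.e. which does not contain $e$ edges spanned by $v$ vertices. Then for every fixed integer $r\ge 3$ and every $e\in\{4,5,7,8\}$ it holds, for all sufficiently large $n$, that $$f_r(n,\,e(r-2)+3,\,e)>n^{2-o(1)}.$$ That is, for each such $r$ and $e$ there is a function $\delta:\mathbb{N}\to\mathbb{R}$ with $\delta(n)\to 0$ as $n\to\infty$ such that $f_r(n,e(r-2)+3,e)>n^{2-\delta(n)}$ for all sufficiently large $n$. -/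

import Mathlib

/-- A hypergraph on the vertex set `V` is given by its edge set `H : Finset (Finset V)`.
It is `r`-uniform if every edge has exactly `r` vertices. -/
def IsUniformHypergraph {V : Type*} (r : ℕ) (H : Finset (Finset V)) : Prop :=
  ∀ A ∈ H, A.card = r

/-- `H` contains no `e` distinct edges spanned by at most `v` vertices: the union of any `e`
distinct edges of `H` has more than `v` vertices. -/
def IsSparseHypergraph {V : Type*} [DecidableEq V] (v e : ℕ) (H : Finset (Finset V)) : Prop :=
  ∀ S ⊆ H, S.card = e → v + 1 ≤ (S.biUnion id).card

open Classical in
/-- The Brown--Erdős--Sós function `f_r(n, v, e)`: the maximum number of edges of an `r`-uniform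
hypergraph on `n` vertices that does not contain `e` edges spanned by `v` vertices. -/
noncomputable def brownErdosSos (r n v e : ℕ) : ℕ :=
  (Finset.univ.filter fun H : Finset (Finset (Fin n)) =>
    IsUniformHypergraph r H ∧ IsSparseHypergraph v e H).sup Finset.card

/-! Edges are points, coloured by `Fin r`: the vertex of colour `i` on the edge `p` is `π i p`, each
colour having its own copy of the vertex set. A set `S` of `e` edges spans `r * e - saving π S`
vertices, so the theorem needs many edges with `saving π S ≤ 2 * e - 4` whenever `S` has `e`
elements.

Local part. Being rainbow-free suffices for `e` in `{4, 5, 7, 8}`. Without triangles, some point of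
a small set meets others in few colours; deleting it settles 4 and 5 points. For 7 and 8 points
(`saving_seven`, `saving_eight`), too large a saving forces either four common neighbours of two
points that do not meet, or a nearly complete 4 by 4 bipartite pattern. Both contain a rainbow
four-cycle.

Construction. An edge is a pair `(x, m)` of `d`-tuples of polynomials in `r` variables with bounded
exponents and coefficients; its vertex of colour `i` is `x + Yᵢ m`. Going round a cycle, the `x`
cancel and a linear relation among the `m` remains. Substituting powers of `D` for the variables, in
an order that increases along the cycle, turns it into a convex combination. If the values of `m`
lie on a sphere for each of the `r!` orders, strict convexity makes the cycle degenerate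
(`eq_of_monotone_walk`).

Count. Fixing the `r!` squared radii costs a factor that does not grow exponentially in `d`. With `K
= d * (L + 1) ^ r`, there are about `D ^ K` vertices and `D ^ (K + (d - 2 * r!) * L ^ r)` edges up
to constants, so the exponent tends to 2 as `L` and `d` grow. -/

/-- A family of colourings `π i` of a point set, viewed as a partite linear hypergraph whose edges are
the points, that has neither triangles nor rainbow cycles of length four. -/
structure IsRainbowFree {ι P V : Type*} (π : ι → P → V) : Prop where
  linear : ∀ {i j : ι} {p q : P}, i ≠ j → π i p = π i q → π j p = π j q → p = q
  triangle : ∀ {i j k : ι} {p q s : P}, i ≠ j → j ≠ k → i ≠ k →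
    π i p = π i q → π j q = π j s → π k s = π k p → p = q
  quad : ∀ {i j k l : ι} {p q s t : P}, i ≠ j → i ≠ k → i ≠ l → j ≠ k → j ≠ l → k ≠ l →
    π i p = π i q → π j q = π j s → π k s = π k t → π l t = π l p → p = q

set_option linter.unusedSectionVars false

/-! ### Savings of small sets in a rainbow-free family: deletion of points and common neighbours. -/

section Sparse

variable {ι P V : Type*} [Fintype ι] [DecidableEq ι] [DecidableEq P] [DecidableEq V]

/-- The number of vertices that are saved by coincidences among the points of `S`. -/
def saving (π : ι → P → V) (S : Finset P) : ℕ :=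
  ∑ i, (S.card - (S.image (π i)).card)

/-- The colours in which `x` meets another point of `S`. -/
def meetColors (π : ι → P → V) (S : Finset P) (x : P) : Finset ι :=
  Finset.univ.filter fun i => ∃ y ∈ S, y ≠ x ∧ π i y = π i x

/-- The points of `S` that meet `x`. -/
def neighbors (π : ι → P → V) (S : Finset P) (x : P) : Finset P :=
  S.filter fun y => y ≠ x ∧ ∃ i, π i y = π i x

/-- The points of `S` that meet `x` in a colour other than `i`. -/
def neighborsOff (π : ι → P → V) (S : Finset P) (x : P) (i : ι) : Finset P :=
  S.filter fun y => y ≠ x ∧ ∃ j, j ≠ i ∧ π j y = π j x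

variable {π : ι → P → V} {S : Finset P}

lemma mem_meetColors {x : P} {i : ι} :
    i ∈ meetColors π S x ↔ ∃ y ∈ S, y ≠ x ∧ π i y = π i x := by
  simp [meetColors]

lemma mem_neighbors {x y : P} :
    y ∈ neighbors π S x ↔ y ∈ S ∧ y ≠ x ∧ ∃ i, π i y = π i x := by
  simp [neighbors]

lemma mem_neighborsOff {x y : P} {i : ι} :
    y ∈ neighborsOff π S x i ↔ y ∈ S ∧ y ≠ x ∧ ∃ j, j ≠ i ∧ π j y = π j x := by
  simp [neighborsOff]

lemma neighborsOff_subset_neighbors {x : P} {i : ι} :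
    neighborsOff π S x i ⊆ neighbors π S x := by
  intro y hy
  obtain ⟨h1, h2, j, -, hj⟩ := mem_neighborsOff.1 hy
  exact mem_neighbors.2 ⟨h1, h2, j, hj⟩

lemma mem_neighbors_comm {x y : P} (hx : x ∈ S) (h : y ∈ neighbors π S x) :
    x ∈ neighbors π S y := by
  obtain ⟨-, h2, i, hi⟩ := mem_neighbors.1 h
  exact mem_neighbors.2 ⟨hx, h2.symm, i, hi.symm⟩

/-- In each colour, erasing `x` lowers the size of the image exactly when no other point shares that
vertex. The degree of `x`, counted in colours, is thus the saving lost with `x`. -/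
lemma saving_eq_erase_add {x : P} (hx : x ∈ S) :
    saving π S = saving π (S.erase x) + (meetColors π S x).card := by
  unfold saving meetColors
  rw [Finset.card_filter, ← Finset.sum_add_distrib]
  refine Finset.sum_congr rfl fun i _ => ?_
  have hS : insert x (S.erase x) = S := Finset.insert_erase hx
  have him : S.image (π i) = insert (π i x) ((S.erase x).image (π i)) := by
    rw [← Finset.image_insert, hS]
  have hc : S.card = (S.erase x).card + 1 := (Finset.card_erase_add_one hx).symm
  have hle : ((S.erase x).image (π i)).card ≤ (S.erase x).card := Finset.card_image_le
  by_cases h : ∃ y ∈ S, y ≠ x ∧ π i y = π i x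
  · have hm : π i x ∈ (S.erase x).image (π i) := by
      obtain ⟨y, hy, hyx, hxy⟩ := h
      exact Finset.mem_image.2 ⟨y, Finset.mem_erase.2 ⟨hyx, hy⟩, hxy⟩
    rw [him, Finset.insert_eq_of_mem hm, if_pos h]
    omega
  · have hm : π i x ∉ (S.erase x).image (π i) := by
      intro hm
      obtain ⟨y, hy, hxy⟩ := Finset.mem_image.1 hm
      exact h ⟨y, Finset.mem_of_mem_erase hy, Finset.ne_of_mem_erase hy, hxy⟩
    rw [him, Finset.card_insert_of_notMem hm, if_neg h]
    omega

lemma IsRainbowFree.card_meetColors_erase_le (h : IsRainbowFree π) (x : P) (i : ι) :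
    ((meetColors π S x).erase i).card ≤ (neighborsOff π S x i).card := by
  have hex : ∀ j ∈ (meetColors π S x).erase i, ∃ y ∈ S, y ≠ x ∧ π j y = π j x := fun j hj =>
    mem_meetColors.1 (Finset.mem_of_mem_erase hj)
  have : Nonempty P := ⟨x⟩
  choose! f hf using hex
  refine Finset.card_le_card_of_injOn f ?_ ?_
  · intro j hj
    exact mem_neighborsOff.2 ⟨(hf j hj).1, (hf j hj).2.1, j, Finset.ne_of_mem_erase hj,
      (hf j hj).2.2⟩
  · intro j hj k hk hjk
    by_contra hne
    refine (hf j hj).2.1 (h.linear hne (hf j hj).2.2 ?_)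
    rw [hjk]
    exact (hf k hk).2.2

lemma IsRainbowFree.card_meetColors_le (h : IsRainbowFree π) (x : P) :
    (meetColors π S x).card ≤ (neighbors π S x).card := by
  have hex : ∀ j ∈ meetColors π S x, ∃ y ∈ S, y ≠ x ∧ π j y = π j x := fun j hj =>
    mem_meetColors.1 hj
  have : Nonempty P := ⟨x⟩
  choose! f hf using hex
  refine Finset.card_le_card_of_injOn f ?_ ?_
  · intro j hj
    exact mem_neighbors.2 ⟨(hf j hj).1, (hf j hj).2.1, j, (hf j hj).2.2⟩
  · intro j hj k hk hjk
    by_contra hne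
    refine (hf j hj).2.1 (h.linear hne (hf j hj).2.2 ?_)
    rw [hjk]
    exact (hf k hk).2.2

lemma IsRainbowFree.card_meetColors_le_neighborsOff (h : IsRainbowFree π) (x : P) (i : ι) :
    (meetColors π S x).card ≤ (neighborsOff π S x i).card + 1 := by
  have h1 := h.card_meetColors_erase_le (S := S) x i
  have h2 := Finset.pred_card_le_card_erase (s := meetColors π S x) (a := i)
  omega

/-- Two points that meet in colours `i ≠ j` with a common point do not meet each other. -/
lemma IsRainbowFree.not_meet (h : IsRainbowFree π) {i j k : ι} {x y z : P} (hij : i ≠ j)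
    (hxy : x ≠ y) (hyz : y ≠ z) (h1 : π i x = π i y) (h2 : π j y = π j z) :
    π k z ≠ π k x := by
  intro h3
  rcases eq_or_ne k i with rfl | hki
  · exact hyz (h.linear hij.symm h2 (h1.symm.trans h3.symm))
  rcases eq_or_ne k j with rfl | hkj
  · exact hxy (h.linear hij h1 (h3.symm.trans h2.symm))
  · exact hxy (h.triangle hij hkj.symm hki.symm h1 h2 h3)

/-- The points of `S` that neither equal `x` nor meet it. -/
def strangers (π : ι → P → V) (S : Finset P) (x : P) : Finset P :=
  (S.erase x) \ neighbors π S x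

lemma mem_strangers {x y : P} :
    y ∈ strangers π S x ↔ y ∈ S ∧ y ≠ x ∧ ∀ i, π i y ≠ π i x := by
  simp only [strangers, Finset.mem_sdiff, Finset.mem_erase, mem_neighbors]
  grind

lemma card_strangers {x : P} (hx : x ∈ S) :
    (strangers π S x).card + (neighbors π S x).card + 1 = S.card := by
  have hsub : neighbors π S x ⊆ S.erase x := by
    intro y hy
    obtain ⟨h1, h2, -⟩ := mem_neighbors.1 hy
    exact Finset.mem_erase.2 ⟨h2, h1⟩
  have := Finset.card_sdiff_add_card_eq_card hsub
  have h2 := Finset.card_erase_add_one hx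
  unfold strangers
  omega

lemma IsRainbowFree.neighborsOff_subset_strangers (h : IsRainbowFree π) {x y : P} {i : ι}
    (hxy : x ≠ y) (hi : π i x = π i y) : neighborsOff π S y i ⊆ strangers π S x := by
  intro z hz
  obtain ⟨hz1, hz2, j, hji, hj⟩ := mem_neighborsOff.1 hz
  refine mem_strangers.2 ⟨hz1, ?_, fun k => ?_⟩
  · rintro rfl
    exact hxy (h.linear hji hj hi)
  · exact h.not_meet hji.symm hxy hz2.symm hi hj.symm

lemma IsRainbowFree.card_neighbors_add_le (h : IsRainbowFree π) {x y : P} (hx : x ∈ S)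
    (hy : y ∈ neighbors π S x) :
    (neighbors π S x).card + (meetColors π S y).card ≤ S.card := by
  obtain ⟨-, hyx, i, hi⟩ := mem_neighbors.1 hy
  have h1 := h.card_meetColors_le_neighborsOff (S := S) y i
  have h2 := Finset.card_le_card (h.neighborsOff_subset_strangers (S := S) hyx.symm hi.symm)
  have h3 := card_strangers (π := π) hx
  omega

/-- A Mantel-type count: `x` has at least `k` neighbours, and one of them has at least `k - 1`
neighbours off the colour shared with `x`, all strangers of `x`. With `x` itself this makes `2 * k`
points. -/
lemma IsRainbowFree.two_mul_le_card (h : IsRainbowFree π) {k : ℕ} (hS : S.Nonempty) (hk : 0 < k)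
    (hdeg : ∀ x ∈ S, k ≤ (meetColors π S x).card) : 2 * k ≤ S.card := by
  obtain ⟨x, hx⟩ := hS
  have h1 := (hdeg x hx).trans (h.card_meetColors_le x)
  obtain ⟨y, hy⟩ := Finset.card_pos.1 (hk.trans_le h1)
  have h2 := h.card_neighbors_add_le hx hy
  have h3 := hdeg y (mem_neighbors.1 hy).1
  omega

lemma IsRainbowFree.exists_card_meetColors_lt (h : IsRainbowFree π) {k : ℕ} (hS : S.Nonempty)
    (hk : 0 < k) (hcard : S.card < 2 * k) : ∃ x ∈ S, (meetColors π S x).card < k := by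
  by_contra! hcon
  have := h.two_mul_le_card hS hk hcon
  omega

/-- Iterating gives 1, 2, 4, 6, 9 for 2 to 6 points. The target `2 * e - 4` is met at 4 and 5 but
not at 6, and one more step would give 12 at 7 points, where 10 is needed. -/
lemma IsRainbowFree.saving_step (h : IsRainbowFree π) {n k b : ℕ} (hn : n + 1 < 2 * k)
    (hb : ∀ T : Finset P, T.card = n → saving π T ≤ b) (S : Finset P) (hS : S.card = n + 1) :
    saving π S ≤ b + (k - 1) := by
  obtain ⟨x, hx, hlt⟩ := h.exists_card_meetColors_lt (S := S) (k := k)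
    (Finset.card_pos.1 (by omega)) (by omega) (by omega)
  have h1 := hb (S.erase x) (by rw [Finset.card_erase_of_mem hx, hS]; rfl)
  rw [saving_eq_erase_add hx]
  omega

lemma saving_of_card_eq_one (S : Finset P) (hS : S.card = 1) : saving π S ≤ 0 := by
  obtain ⟨x, rfl⟩ := Finset.card_eq_one.1 hS
  simp [saving]

lemma IsRainbowFree.saving_two (h : IsRainbowFree π) (S : Finset P) (hS : S.card = 2) :
    saving π S ≤ 1 :=
  h.saving_step (k := 2) (by norm_num) saving_of_card_eq_one S hS

lemma IsRainbowFree.saving_three (h : IsRainbowFree π) (S : Finset P) (hS : S.card = 3) :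
    saving π S ≤ 2 :=
  h.saving_step (k := 2) (by norm_num) h.saving_two S hS

lemma IsRainbowFree.saving_four (h : IsRainbowFree π) (S : Finset P) (hS : S.card = 4) :
    saving π S ≤ 4 :=
  h.saving_step (k := 3) (by norm_num) h.saving_three S hS

lemma IsRainbowFree.saving_five (h : IsRainbowFree π) (S : Finset P) (hS : S.card = 5) :
    saving π S ≤ 6 :=
  h.saving_step (k := 3) (by norm_num) h.saving_four S hS

lemma IsRainbowFree.saving_six (h : IsRainbowFree π) (S : Finset P) (hS : S.card = 6) :
    saving π S ≤ 9 :=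
  h.saving_step (k := 4) (by norm_num) h.saving_five S hS

/-- The colours of a four-cycle `u, w, v, w'` with `u`, `v` not meeting: it is not rainbow. -/
lemma IsRainbowFree.color_eq_or (h : IsRainbowFree π) {u v w w' : P} {a b a' b' : ι}
    (huv : ∀ i, π i u ≠ π i v) (hw : w ≠ w') (hwu : w ≠ u) (hwv : w ≠ v)
    (ha : π a w = π a u) (hb : π b w = π b v) (ha' : π a' w' = π a' u)
    (hb' : π b' w' = π b' v) :
    a ≠ b ∧ a ≠ a' ∧ b ≠ b' ∧ (a = b' ∨ a' = b) := by
  have hab : a ≠ b := by rintro rfl; exact huv a (ha.symm.trans hb)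
  have hab' : a' ≠ b' := by rintro rfl; exact huv a' (ha'.symm.trans hb')
  have haa : a ≠ a' := by
    rintro rfl
    exact h.not_meet (k := b') hab.symm hwv.symm hw hb.symm (ha.trans ha'.symm) hb'
  have hbb : b ≠ b' := by
    rintro rfl
    exact h.not_meet (k := a') hab hwu.symm hw ha.symm (hb.trans hb'.symm) ha'
  refine ⟨hab, haa, hbb, ?_⟩
  by_contra! hcon
  exact hwu (h.quad (i := a) (j := a') (k := b') (l := b) haa hcon.1 hab hab'
    hcon.2 hbb.symm ha ha'.symm hb' hb.symm)

/-- Two points that do not meet have at most three common neighbours. -/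
lemma IsRainbowFree.card_common_le (h : IsRainbowFree π) {u v : P} (huv : ∀ i, π i u ≠ π i v)
    {W : Finset P} (hW : ∀ w ∈ W, w ∈ neighbors π S u ∧ w ∈ neighbors π S v) : W.card ≤ 3 := by
  by_contra! hcard
  obtain ⟨W', hW', hc⟩ := Finset.exists_subset_card_eq (show 4 ≤ W.card from hcard)
  obtain ⟨w₁, w₂, w₃, w₄, h12, h13, h14, h23, h24, h34, rfl⟩ := Finset.card_eq_four.1 hc
  have key : ∀ w ∈ ({w₁, w₂, w₃, w₄} : Finset P), w ≠ u ∧ w ≠ v ∧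
      (∃ a, π a w = π a u) ∧ ∃ b, π b w = π b v := by
    intro w hw
    obtain ⟨h1, h2⟩ := hW w (hW' hw)
    exact ⟨(mem_neighbors.1 h1).2.1, (mem_neighbors.1 h2).2.1, (mem_neighbors.1 h1).2.2,
      (mem_neighbors.1 h2).2.2⟩
  obtain ⟨n1, m1, ⟨a₁, ha₁⟩, b₁, hb₁⟩ := key w₁ (by simp)
  obtain ⟨n2, m2, ⟨a₂, ha₂⟩, b₂, hb₂⟩ := key w₂ (by simp)
  obtain ⟨n3, m3, ⟨a₃, ha₃⟩, b₃, hb₃⟩ := key w₃ (by simp)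
  obtain ⟨n4, m4, ⟨a₄, ha₄⟩, b₄, hb₄⟩ := key w₄ (by simp)
  have e12 := h.color_eq_or huv h12 n1 m1 ha₁ hb₁ ha₂ hb₂
  have e13 := h.color_eq_or huv h13 n1 m1 ha₁ hb₁ ha₃ hb₃
  have e14 := h.color_eq_or huv h14 n1 m1 ha₁ hb₁ ha₄ hb₄
  have e23 := h.color_eq_or huv h23 n2 m2 ha₂ hb₂ ha₃ hb₃
  have e24 := h.color_eq_or huv h24 n2 m2 ha₂ hb₂ ha₄ hb₄
  have e34 := h.color_eq_or huv h34 n3 m3 ha₃ hb₃ ha₄ hb₄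
  -- Draw an arc from `w` to `w'` when the colour of `w` at `u` equals that of `w'` at `v`. Every
  -- pair is joined by an arc, while in- and outdegrees are at most one; four vertices would need
  -- six arcs and have at most four.
  clear! S u v
  grind

end Sparse

/-! ### Sets of seven and eight points. -/

section SparseEight

variable {ι P V : Type*} [Fintype ι] [DecidableEq ι] [DecidableEq P] [DecidableEq V]
variable {π : ι → P → V} {S : Finset P}

lemma IsRainbowFree.disjoint_neighborsOff (h : IsRainbowFree π) {x y : P} {i : ι} (hxy : x ≠ y)
    (hi : π i x = π i y) : Disjoint (neighborsOff π S x i) (neighborsOff π S y i) := by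
  refine Finset.disjoint_left.2 fun w hwx hwy => ?_
  obtain ⟨-, -, j, -, hj⟩ := mem_neighborsOff.1 hwx
  obtain ⟨-, hwy', k, hk, hk'⟩ := mem_neighborsOff.1 hwy
  exact h.not_meet hk.symm hxy hwy'.symm hi hk'.symm hj

lemma IsRainbowFree.notMem_neighborsOff (h : IsRainbowFree π) {x y : P} {i : ι}
    (hi : π i x = π i y) : x ∉ neighborsOff π S y i := by
  intro hx
  obtain ⟨-, hne, j, hji, hj⟩ := mem_neighborsOff.1 hx
  exact hne (h.linear hji hj hi)

/-- Each of the three points has two neighbours off the colour `i`. Without triangles these sets are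
pairwise disjoint and avoid the three points, giving nine points in all. -/
lemma IsRainbowFree.no_three_collinear (h : IsRainbowFree π) (hS : S.card ≤ 8)
    (hdeg : ∀ x ∈ S, 3 ≤ (meetColors π S x).card) {x y z : P} {i : ι} (hx : x ∈ S) (hy : y ∈ S)
    (hz : z ∈ S) (hxy : x ≠ y) (hxz : x ≠ z) (hyz : y ≠ z) (h1 : π i x = π i y)
    (h2 : π i x = π i z) : False := by
  have key : ∀ w ∈ S, 2 ≤ (neighborsOff π S w i).card := fun w hw => by
    have := hdeg w hw
    have := h.card_meetColors_le_neighborsOff (S := S) w i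
    omega
  have h3 : π i y = π i z := h1.symm.trans h2
  have d1 := h.disjoint_neighborsOff (S := S) hxy h1
  have d2 := h.disjoint_neighborsOff (S := S) hxz h2
  have d3 := h.disjoint_neighborsOff (S := S) hyz h3
  have d4 : Disjoint (neighborsOff π S x i ∪ neighborsOff π S y i) (neighborsOff π S z i) :=
    Finset.disjoint_union_left.2 ⟨d2, d3⟩
  have d5 : Disjoint (neighborsOff π S x i ∪ neighborsOff π S y i ∪ neighborsOff π S z i)
      {x, y, z} := by
    have hself : ∀ w w' : P, π i w' = π i w → w' ∉ neighborsOff π S w i :=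
      fun w w' hw => h.notMem_neighborsOff hw
    refine Finset.disjoint_right.2 fun w hw => ?_
    simp only [Finset.mem_insert, Finset.mem_singleton] at hw
    simp only [Finset.mem_union, not_or]
    rcases hw with rfl | rfl | rfl
    · exact ⟨⟨hself _ _ rfl, hself _ _ h1⟩, hself _ _ h2⟩
    · exact ⟨⟨hself _ _ h1.symm, hself _ _ rfl⟩, hself _ _ h3⟩
    · exact ⟨⟨hself _ _ h2.symm, hself _ _ h3.symm⟩, hself _ _ rfl⟩
  have hsub : neighborsOff π S x i ∪ neighborsOff π S y i ∪ neighborsOff π S z i ∪ {x, y, z} ⊆ S := by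
    have hoff : ∀ w, neighborsOff π S w i ⊆ S := fun w => Finset.filter_subset _ _
    refine Finset.union_subset (Finset.union_subset (Finset.union_subset (hoff _) (hoff _))
      (hoff _)) ?_
    intro w hw
    simp only [Finset.mem_insert, Finset.mem_singleton] at hw
    rcases hw with rfl | rfl | rfl <;> assumption
  have hc := Finset.card_le_card hsub
  rw [Finset.card_union_of_disjoint d5, Finset.card_union_of_disjoint d4,
    Finset.card_union_of_disjoint d1, Finset.card_eq_three.2 ⟨x, y, z, hxy, hxz, hyz, rfl⟩] at hc
  have := key x hx
  have := key y hy
  have := key z hz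
  omega

/-- When colour classes have at most two points, each coincidence saves one vertex and contributes
to two degrees. -/
lemma two_mul_saving_le
    (hline : ∀ i : ι, ∀ x ∈ S, ∀ y ∈ S, ∀ z ∈ S, x ≠ y → x ≠ z → y ≠ z → π i x = π i y →
      π i x = π i z → False) :
    2 * saving π S ≤ ∑ x ∈ S, (meetColors π S x).card := by
  have hswap : ∑ x ∈ S, (meetColors π S x).card =
      ∑ i, (S.filter fun x => ∃ y ∈ S, y ≠ x ∧ π i y = π i x).card := by
    simp only [meetColors, Finset.card_filter]
    exact Finset.sum_comm
  rw [hswap, saving, Finset.mul_sum]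
  refine Finset.sum_le_sum fun i _ => ?_
  set B := S.filter fun x => ∃ y ∈ S, y ≠ x ∧ π i y = π i x with hB
  have hBS : B ⊆ S := Finset.filter_subset _ _
  have h1 : S.card = ∑ v ∈ S.image (π i), (S.filter fun x => π i x = v).card :=
    Finset.card_eq_sum_card_image _ _
  have h2 : B.card = ∑ v ∈ S.image (π i), (B.filter fun x => π i x = v).card :=
    Finset.card_eq_sum_card_fiberwise fun x hx => Finset.mem_image_of_mem _ (hBS hx)
  have h3 : ∀ v ∈ S.image (π i), 2 * (S.filter fun x => π i x = v).card ≤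
      2 + (B.filter fun x => π i x = v).card := by
    intro v _
    rcases Nat.lt_or_ge 1 (S.filter fun x => π i x = v).card with hlt | hle
    · have hle2 : (S.filter fun x => π i x = v).card ≤ 2 := by
        by_contra! hgt
        obtain ⟨x, y, z, hx, hy, hz, hxy, hxz, hyz⟩ := Finset.two_lt_card_iff.1 hgt
        rw [Finset.mem_filter] at hx hy hz
        exact hline i x hx.1 y hy.1 z hz.1 hxy hxz hyz (hx.2.trans hy.2.symm)
          (hx.2.trans hz.2.symm)
      have hsub : (S.filter fun x => π i x = v) ⊆ B.filter fun x => π i x = v := by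
        intro x hx
        obtain ⟨y, hy, hyx⟩ := Finset.exists_mem_ne hlt x
        rw [Finset.mem_filter] at hx hy
        exact Finset.mem_filter.2 ⟨Finset.mem_filter.2 ⟨hx.1, y, hy.1, hyx,
          hy.2.trans hx.2.symm⟩, hx.2⟩
      have := Finset.card_le_card hsub
      omega
    · omega
  have h4 := Finset.sum_le_sum h3
  rw [← Finset.mul_sum, ← h1, Finset.sum_add_distrib, ← h2, Finset.sum_const, smul_eq_mul] at h4
  omega

/-- All but one of the colours in which a neighbour of `x` meets other points lead to strangers of `x`. -/
lemma IsRainbowFree.card_meetColors_le_inter (h : IsRainbowFree π) {x y : P}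
    (hy : y ∈ neighbors π S x) :
    (meetColors π S y).card ≤ (strangers π S x ∩ neighbors π S y).card + 1 := by
  obtain ⟨-, hyx, i, hi⟩ := mem_neighbors.1 hy
  have h1 := h.card_meetColors_le_neighborsOff (S := S) y i
  have h2 := Finset.card_le_card (Finset.subset_inter
    (h.neighborsOff_subset_strangers (S := S) hyx.symm hi.symm)
    (neighborsOff_subset_neighbors (π := π) (S := S) (x := y) (i := i)))
  omega

/-- All but one of the colours at `y` lead to different strangers of `x`; if there are no more
strangers than that, `y` meets all of them. -/
lemma IsRainbowFree.mem_neighbors_of_mem_strangers (h : IsRainbowFree π) {x y z : P}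
    (hy : y ∈ neighbors π S x) (hz : z ∈ strangers π S x)
    (hcard : (strangers π S x).card < (meetColors π S y).card) : y ∈ neighbors π S z := by
  have h1 := h.card_meetColors_le_inter hy
  have h2 : strangers π S x ∩ neighbors π S y = strangers π S x :=
    Finset.eq_of_subset_of_card_le Finset.inter_subset_left (by omega)
  have h3 : z ∈ neighbors π S y := Finset.mem_of_mem_inter_right (h2.symm ▸ hz)
  exact mem_neighbors_comm (mem_neighbors.1 hy).1 h3

lemma IsRainbowFree.saving_seven (h : IsRainbowFree π) (S : Finset P) (hS : S.card = 7) :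
    saving π S ≤ 10 := by
  by_contra! hlt
  by_cases hdeg : ∀ x ∈ S, 3 ≤ (meetColors π S x).card
  · have hsum := two_mul_saving_le (π := π) (S := S) fun i x hx y hy z hz =>
      h.no_three_collinear (by omega) hdeg hx hy hz
    -- The degree sum is at least 22, above `3 * 7`. Then `x` has four neighbours and two strangers,
    -- and every neighbour meets both strangers: four common neighbours.
    obtain ⟨x, hx, hx4⟩ : ∃ x ∈ S, 3 < (meetColors π S x).card := by
      refine Finset.exists_lt_of_sum_lt (s := S) (f := fun _ => 3) ?_
      rw [Finset.sum_const, hS, smul_eq_mul]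
      omega
    have h1 := h.card_meetColors_le (S := S) x
    obtain ⟨y, hy⟩ : (neighbors π S x).Nonempty := Finset.card_pos.1 (by omega)
    have h2 := h.card_neighbors_add_le hx hy
    have h3 := hdeg y (mem_neighbors.1 hy).1
    have h4 := card_strangers (π := π) hx
    obtain ⟨z, hz⟩ : (strangers π S x).Nonempty := Finset.card_pos.1 (by omega)
    have h5 := h.card_common_le (S := S) (u := x) (v := z) (W := neighbors π S x)
      (fun i => ((mem_strangers.1 hz).2.2 i).symm) fun w hw =>
        ⟨hw, h.mem_neighbors_of_mem_strangers hw hz (by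
          have := hdeg w (mem_neighbors.1 hw).1
          omega)⟩
    omega
  -- Here `w` has degree two and the other six points save exactly 9, with minimum degree three. The
  -- two points `u`, `v` met by `w` do not meet, and besides `w` they share all the neighbours of
  -- `u` in `T`, at least three.
  · push Not at hdeg
    obtain ⟨w, hw, hw3⟩ := hdeg
    set T := S.erase w with hT
    have hTc : T.card = 6 := by rw [hT, Finset.card_erase_of_mem hw, hS]
    have h1 := saving_eq_erase_add (π := π) hw
    have h2 := h.saving_six T hTc
    rw [← hT] at h1
    have hdegT : ∀ x ∈ T, 3 ≤ (meetColors π T x).card := by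
      intro x hx
      have h3 := saving_eq_erase_add (π := π) hx
      have h4 := h.saving_five (T.erase x) (by rw [Finset.card_erase_of_mem hx, hTc])
      omega
    obtain ⟨i, hi, j, hj, hij⟩ := Finset.one_lt_card.1 (show 1 < (meetColors π S w).card by omega)
    obtain ⟨u, huS, huw, hu⟩ := mem_meetColors.1 hi
    obtain ⟨v, hvS, hvw, hv⟩ := mem_meetColors.1 hj
    have huT : u ∈ T := Finset.mem_erase.2 ⟨huw, huS⟩
    have hvT : v ∈ T := Finset.mem_erase.2 ⟨hvw, hvS⟩
    have huv : ∀ k, π k v ≠ π k u := fun k => h.not_meet hij huw hvw.symm hu hv.symm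
    have hvs : v ∈ strangers π T u := mem_strangers.2 ⟨hvT, fun e => huv i (by rw [e]), huv⟩
    have h3 := h.card_meetColors_le (S := T) u
    have h4 := hdegT u huT
    have h5 := card_strangers (π := π) huT
    have hwn : w ∉ neighbors π T u := fun hmem =>
      Finset.notMem_erase w S (mem_neighbors.1 hmem).1
    have h6 := h.card_common_le (S := S) (u := u) (v := v) (W := insert w (neighbors π T u))
      (fun k => (huv k).symm) fun y hy => by
        rcases Finset.mem_insert.1 hy with rfl | hy
        · exact ⟨mem_neighbors.2 ⟨hw, huw.symm, i, hu.symm⟩,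
            mem_neighbors.2 ⟨hw, hvw.symm, j, hv.symm⟩⟩
        · have hyv := h.mem_neighbors_of_mem_strangers hy hvs (by
            have := hdegT y (mem_neighbors.1 hy).1
            omega)
          have hmono : ∀ a, neighbors π T a ⊆ neighbors π S a := fun a =>
            Finset.filter_subset_filter _ (Finset.erase_subset _ _)
          exact ⟨hmono _ hy, hmono _ hyv⟩
    rw [Finset.card_insert_of_notMem hwn] at h6
    omega

/-- There is no `K_{4,4}` minus a matching of three edges: here `x` meets `y₁, y₂, y₃, y₄`, `z₂` misses
`y₂`, `z₃` misses `y₃` and `z₄` misses `y₄`. -/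
lemma IsRainbowFree.no_punctured_grid (h : IsRainbowFree π) {x y₁ y₂ y₃ y₄ z₂ z₃ z₄ : P}
    (h12 : y₁ ≠ y₂) (h13 : y₁ ≠ y₃) (h14 : y₁ ≠ y₄) (h23 : y₂ ≠ y₃) (h24 : y₂ ≠ y₄) (h34 : y₃ ≠ y₄)
    (hz₂ : ∀ i, π i x ≠ π i z₂) (hz₃ : ∀ i, π i x ≠ π i z₃) (hz₄ : ∀ i, π i x ≠ π i z₄)
    (k23 : ∀ i, π i z₂ ≠ π i z₃) (k24 : ∀ i, π i z₂ ≠ π i z₄) (k34 : ∀ i, π i z₃ ≠ π i z₄)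
    (x₁ : y₁ ∈ neighbors π S x) (x₂ : y₂ ∈ neighbors π S x) (x₃ : y₃ ∈ neighbors π S x)
    (x₄ : y₄ ∈ neighbors π S x)
    (p₁ : y₁ ∈ neighbors π S z₂) (p₃ : y₃ ∈ neighbors π S z₂) (p₄ : y₄ ∈ neighbors π S z₂)
    (q₁ : y₁ ∈ neighbors π S z₃) (q₂ : y₂ ∈ neighbors π S z₃) (q₄ : y₄ ∈ neighbors π S z₃)
    (s₁ : y₁ ∈ neighbors π S z₄) (s₂ : y₂ ∈ neighbors π S z₄) (s₃ : y₃ ∈ neighbors π S z₄) :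
    False := by
  obtain ⟨-, nx₁, a₁, ha₁⟩ := mem_neighbors.1 x₁
  obtain ⟨-, nx₂, a₂, ha₂⟩ := mem_neighbors.1 x₂
  obtain ⟨-, nx₃, a₃, ha₃⟩ := mem_neighbors.1 x₃
  obtain ⟨-, nx₄, a₄, ha₄⟩ := mem_neighbors.1 x₄
  obtain ⟨-, np₁, b₁, hb₁⟩ := mem_neighbors.1 p₁
  obtain ⟨-, np₃, b₃, hb₃⟩ := mem_neighbors.1 p₃
  obtain ⟨-, np₄, b₄, hb₄⟩ := mem_neighbors.1 p₄
  obtain ⟨-, nq₁, c₁, hc₁⟩ := mem_neighbors.1 q₁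
  obtain ⟨-, nq₂, c₂, hc₂⟩ := mem_neighbors.1 q₂
  obtain ⟨-, nq₄, c₄, hc₄⟩ := mem_neighbors.1 q₄
  obtain ⟨-, ns₁, d₁, hd₁⟩ := mem_neighbors.1 s₁
  obtain ⟨-, ns₂, d₂, hd₂⟩ := mem_neighbors.1 s₂
  obtain ⟨-, ns₃, d₃, hd₃⟩ := mem_neighbors.1 s₃
  have e1 := h.color_eq_or hz₂ h13 nx₁ np₁ ha₁ hb₁ ha₃ hb₃
  have e2 := h.color_eq_or hz₂ h14 nx₁ np₁ ha₁ hb₁ ha₄ hb₄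
  have e3 := h.color_eq_or hz₂ h34 nx₃ np₃ ha₃ hb₃ ha₄ hb₄
  have e4 := h.color_eq_or hz₃ h12 nx₁ nq₁ ha₁ hc₁ ha₂ hc₂
  have e5 := h.color_eq_or hz₃ h14 nx₁ nq₁ ha₁ hc₁ ha₄ hc₄
  have e6 := h.color_eq_or hz₃ h24 nx₂ nq₂ ha₂ hc₂ ha₄ hc₄
  have e7 := h.color_eq_or hz₄ h12 nx₁ ns₁ ha₁ hd₁ ha₂ hd₂
  have e8 := h.color_eq_or hz₄ h13 nx₁ ns₁ ha₁ hd₁ ha₃ hd₃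
  have e9 := h.color_eq_or hz₄ h23 nx₂ ns₂ ha₂ hd₂ ha₃ hd₃
  have f1 := h.color_eq_or k23 h14 np₁ nq₁ hb₁ hc₁ hb₄ hc₄
  have f2 := h.color_eq_or k24 h13 np₁ ns₁ hb₁ hd₁ hb₃ hd₃
  have f3 := h.color_eq_or k34 h12 nq₁ ns₁ hc₁ hd₁ hc₂ hd₂
  -- Three common neighbours force the colours at the two ends to differ by a cyclic shift. Hence
  -- `b₁ ∈ {a₃, a₄}`, `b₄ ∈ {a₁, a₃}`, `c₁ ∈ {a₂, a₄}`, `c₄ ∈ {a₁, a₂}`, so neither `b₁ = c₄` nor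
  -- `b₄ = c₁`, and the cycle `z₂, y₁, z₃, y₄` is rainbow.
  clear! S x y₁ y₂ y₃ y₄ z₂ z₃ z₄
  grind

lemma IsRainbowFree.saving_eight (h : IsRainbowFree π) (S : Finset P) (hS : S.card = 8) :
    saving π S ≤ 12 := by
  by_contra! hlt
  have hdeg : ∀ x ∈ S, 3 ≤ (meetColors π S x).card := by
    intro x hx
    have h3 := saving_eq_erase_add (π := π) hx
    have h4 := h.saving_seven (S.erase x) (by rw [Finset.card_erase_of_mem hx, hS])
    omega
  have hline : ∀ i : ι, ∀ x ∈ S, ∀ y ∈ S, ∀ z ∈ S, x ≠ y → x ≠ z → y ≠ z → π i x = π i y →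
      π i x = π i z → False := fun i x hx y hy z hz =>
    h.no_three_collinear (by omega) hdeg hx hy hz
  have hsum := two_mul_saving_le hline
  -- The degree sum is at least 26, above `3 * 8`.
  obtain ⟨x, hx, hx4⟩ : ∃ x ∈ S, 3 < (meetColors π S x).card := by
    refine Finset.exists_lt_of_sum_lt (s := S) (f := fun _ => 3) ?_
    rw [Finset.sum_const, hS, smul_eq_mul]
    omega
  have h1 := h.card_meetColors_le (S := S) x
  obtain ⟨y, hy⟩ : (neighbors π S x).Nonempty := Finset.card_pos.1 (by omega)
  have h2 := h.card_neighbors_add_le hx hy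
  have h3 := hdeg y (mem_neighbors.1 hy).1
  have h4 := card_strangers (π := π) hx
  set Y := neighbors π S x with hY
  set Z := strangers π S x with hZ
  have hYS : ∀ y ∈ Y, y ∈ S := fun y hy => (mem_neighbors.1 hy).1
  have hZS : ∀ z ∈ Z, z ∈ S := fun z hz => (mem_strangers.1 hz).1
  have hxz : ∀ z ∈ Z, ∀ i, π i x ≠ π i z := fun z hz i => ((mem_strangers.1 hz).2.2 i).symm
  have hYZ : ∀ z ∈ Z, (Y ∩ neighbors π S z).card ≤ 3 := fun z hz =>
    h.card_common_le (hxz z hz) fun w hw => Finset.mem_inter.1 hw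
  have hZY : ∀ y ∈ Y, 2 ≤ (Z ∩ neighbors π S y).card := fun y hy => by
    have h5 := h.card_meetColors_le_inter hy
    rw [← hZ] at h5
    have := hdeg y (hYS y hy)
    omega
  -- the number of neighbours of `x` is four
  rcases Nat.lt_or_ge 4 Y.card with h5 | h5
  · obtain ⟨z, hz⟩ : Z.Nonempty := Finset.card_pos.1 (by omega)
    have hsub : Y ⊆ Y ∩ neighbors π S z := fun w hw =>
      Finset.mem_inter.2 ⟨hw, h.mem_neighbors_of_mem_strangers hw hz (by
        have := hdeg w (hYS w hw)
        rw [← hZ]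
        omega)⟩
    have := Finset.card_le_card hsub
    have := hYZ z hz
    omega
  have hYc : Y.card = 4 := by omega
  have hZc : Z.card = 3 := by omega
  -- strangers of `x` do not meet each other
  have hindep : ∀ z ∈ Z, ∀ z' ∈ Z, z ≠ z' → ∀ i, π i z ≠ π i z' := by
    intro z hz z' hz' hne i hi
    obtain ⟨z'', hz'', hn⟩ : ∃ z'' ∈ Z, z'' ∉ ({z, z'} : Finset P) :=
      Finset.exists_mem_notMem_of_card_lt_card (by rw [Finset.card_pair hne]; omega)
    have hboth : ∀ y ∈ Y, y ∈ neighbors π S z → y ∈ neighbors π S z' → False := by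
      intro y hy hyz hyz'
      obtain ⟨-, n1, j, hj⟩ := mem_neighbors.1 hyz
      obtain ⟨-, n2, k, hk⟩ := mem_neighbors.1 hyz'
      rcases eq_or_ne j k with rfl | hjk
      · exact hline j y (hYS y hy) z (hZS z hz) z' (hZS z' hz') n1 n2 hne hj hk
      · exact h.not_meet hjk n1.symm n2 hj.symm hk hi.symm
    -- Each `y` meets two of the three strangers but not both `z` and `z'`, so it meets `z''`, which
    -- then shares four neighbours with `x`.
    have hsub : Y ⊆ Y ∩ neighbors π S z'' := by
      intro y hy
      refine Finset.mem_inter.2 ⟨hy, ?_⟩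
      by_contra hcon
      have hsub2 : (Z ∩ neighbors π S y) ⊆ (Z.erase z'').filter fun a => a ∈ neighbors π S y := by
        intro a ha
        obtain ⟨ha1, ha2⟩ := Finset.mem_inter.1 ha
        refine Finset.mem_filter.2 ⟨Finset.mem_erase.2 ⟨?_, ha1⟩, ha2⟩
        rintro rfl
        exact hcon (mem_neighbors_comm (hYS y hy) ha2)
      have hc := (hZY y hy).trans (Finset.card_le_card hsub2)
      have hc2 : (Z.erase z'').card = 2 := by rw [Finset.card_erase_of_mem hz'', hZc]
      have hfe := Finset.eq_of_subset_of_card_le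
        (Finset.filter_subset (fun a => a ∈ neighbors π S y) (Z.erase z'')) (by omega)
      have hmem : ∀ a ∈ Z, a ≠ z'' → y ∈ neighbors π S a := by
        intro a ha hne'
        have : a ∈ (Z.erase z'').filter fun a => a ∈ neighbors π S y := by
          rw [hfe]; exact Finset.mem_erase.2 ⟨hne', ha⟩
        exact mem_neighbors_comm (hYS y hy) (Finset.mem_filter.1 this).2
      simp only [Finset.mem_insert, Finset.mem_singleton, not_or] at hn
      exact hboth y hy (hmem z hz (Ne.symm hn.1)) (hmem z' hz' (Ne.symm hn.2))
    have := Finset.card_le_card hsub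
    have := hYZ z'' hz''
    omega
  -- degrees
  have hZdeg : ∀ z ∈ Z, (meetColors π S z).card ≤ (Y ∩ neighbors π S z).card := by
    intro z hz
    refine (h.card_meetColors_le z).trans (Finset.card_le_card fun w hw => ?_)
    refine Finset.mem_inter.2 ⟨?_, hw⟩
    obtain ⟨hwS, hwz, i, hi⟩ := mem_neighbors.1 hw
    by_contra hwY
    have hwx : w ≠ x := by
      rintro rfl
      exact hxz z hz i hi
    have hwZ : w ∈ Z := by
      refine mem_strangers.2 ⟨hwS, hwx, fun j hj => hwY (mem_neighbors.2 ⟨hwS, hwx, j, hj⟩)⟩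
    exact hindep w hwZ z hz hwz i hi
  have hYZ3 : ∀ z ∈ Z, (Y ∩ neighbors π S z).card = 3 := fun z hz => by
    have := hYZ z hz
    have := hZdeg z hz
    have := hdeg z (hZS z hz)
    omega
  -- each stranger of `x` misses exactly one neighbour of `x`
  have hmiss : ∀ z ∈ Z, ∃ y ∈ Y, y ∉ neighbors π S z ∧ ∀ y' ∈ Y, y' ≠ y → y' ∈ neighbors π S z := by
    intro z hz
    have hc : (Y \ neighbors π S z).card = 1 := by
      have := Finset.card_sdiff_add_card_inter Y (neighbors π S z)
      have := hYZ3 z hz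
      omega
    obtain ⟨y, hy⟩ := Finset.card_eq_one.1 hc
    have hy' : y ∈ Y \ neighbors π S z := by rw [hy]; exact Finset.mem_singleton_self y
    refine ⟨y, (Finset.mem_sdiff.1 hy').1, (Finset.mem_sdiff.1 hy').2, fun y' hy'Y hne => ?_⟩
    by_contra hcon
    have : y' ∈ Y \ neighbors π S z := Finset.mem_sdiff.2 ⟨hy'Y, hcon⟩
    rw [hy] at this
    exact hne (Finset.mem_singleton.1 this)
  have hdistinct : ∀ z ∈ Z, ∀ z' ∈ Z, z ≠ z' → ∀ y ∈ Y, y ∉ neighbors π S z →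
      y ∈ neighbors π S z' := by
    intro z hz z' hz' hne y hy hyz
    by_contra hyz'
    have hsub : Z ∩ neighbors π S y ⊆ Z \ {z, z'} := by
      intro a ha
      obtain ⟨ha1, ha2⟩ := Finset.mem_inter.1 ha
      refine Finset.mem_sdiff.2 ⟨ha1, fun hmem => ?_⟩
      have hya := mem_neighbors_comm (hYS y hy) ha2
      simp only [Finset.mem_insert, Finset.mem_singleton] at hmem
      rcases hmem with rfl | rfl
      · exact hyz hya
      · exact hyz' hya
    have hc := (hZY y hy).trans (Finset.card_le_card hsub)
    have hpair : ({z, z'} : Finset P) ⊆ Z := by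
      intro a ha
      simp only [Finset.mem_insert, Finset.mem_singleton] at ha
      rcases ha with rfl | rfl <;> assumption
    have := Finset.card_sdiff_add_card_eq_card hpair
    rw [Finset.card_pair hne] at this
    omega
  obtain ⟨z₂, z₃, z₄, g23, g24, g34, hZe⟩ := Finset.card_eq_three.1 hZc
  have m2 : z₂ ∈ Z := by rw [hZe]; simp
  have m3 : z₃ ∈ Z := by rw [hZe]; simp
  have m4 : z₄ ∈ Z := by rw [hZe]; simp
  obtain ⟨y₂, hy₂, n2, t2⟩ := hmiss z₂ m2
  obtain ⟨y₃, hy₃, n3, t3⟩ := hmiss z₃ m3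
  obtain ⟨y₄, hy₄, n4, t4⟩ := hmiss z₄ m4
  have h23 : y₂ ≠ y₃ := by
    rintro rfl; exact n3 (hdistinct z₂ m2 z₃ m3 g23 _ hy₂ n2)
  have h24 : y₂ ≠ y₄ := by
    rintro rfl; exact n4 (hdistinct z₂ m2 z₄ m4 g24 _ hy₂ n2)
  have h34 : y₃ ≠ y₄ := by
    rintro rfl; exact n4 (hdistinct z₃ m3 z₄ m4 g34 _ hy₃ n3)
  obtain ⟨y₁, hy₁, hn⟩ : ∃ y₁ ∈ Y, y₁ ∉ ({y₂, y₃, y₄} : Finset P) :=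
    Finset.exists_mem_notMem_of_card_lt_card
      (by rw [Finset.card_eq_three.2 ⟨y₂, y₃, y₄, h23, h24, h34, rfl⟩]; omega)
  simp only [Finset.mem_insert, Finset.mem_singleton, not_or] at hn
  obtain ⟨h12, h13, h14⟩ := hn
  exact h.no_punctured_grid h12 h13 h14 h23 h24 h34 (hxz _ m2) (hxz _ m3) (hxz _ m4)
    (hindep _ m2 _ m3 g23) (hindep _ m2 _ m4 g24) (hindep _ m3 _ m4 g34) hy₁ hy₂ hy₃ hy₄
    (t2 _ hy₁ h12) (t2 _ hy₃ h23.symm) (t2 _ hy₄ h24.symm)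
    (t3 _ hy₁ h13) (t3 _ hy₂ h23) (t3 _ hy₄ h34.symm)
    (t4 _ hy₁ h14) (t4 _ hy₂ h24) (t4 _ hy₃ h34)

lemma IsRainbowFree.saving_le (h : IsRainbowFree π) {e : ℕ} (he : e ∈ ({4, 5, 7, 8} : Finset ℕ))
    (hS : S.card = e) : saving π S + 4 ≤ 2 * e := by
  simp only [Finset.mem_insert, Finset.mem_singleton] at he
  rcases he with rfl | rfl | rfl | rfl
  · have := h.saving_four S hS
    omega
  · have := h.saving_five S hS
    omega
  · have := h.saving_seven S hS
    omega
  · have := h.saving_eight S hS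
    omega

lemma IsRainbowFree.le_sum_card_image (h : IsRainbowFree π) {e : ℕ}
    (he : e ∈ ({4, 5, 7, 8} : Finset ℕ)) (hS : S.card = e) (hr : 2 ≤ Fintype.card ι) :
    e * (Fintype.card ι - 2) + 4 ≤ ∑ i, (S.image (π i)).card := by
  have h1 := h.saving_le he hS
  have h2 : saving π S + ∑ i, (S.image (π i)).card = Fintype.card ι * e := by
    rw [saving, ← Finset.sum_add_distrib, ← hS, ← smul_eq_mul, ← Finset.card_univ,
      ← Finset.sum_const]
    exact Finset.sum_congr rfl fun i _ => Nat.sub_add_cancel Finset.card_image_le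
  obtain ⟨k, hk⟩ := Nat.exists_eq_add_of_le hr
  rw [hk] at h2 ⊢
  have h3 : (2 + k) * e = 2 * e + e * k := by ring
  rw [Nat.add_sub_cancel_left]
  omega

end SparseEight

/-! ### The polynomial construction and its freedom from rainbow cycles. -/

section ShiftConstruction

/-- Raise the `i`-th exponent of a multi-exponent by one. -/
def raise {r L : ℕ} (i : Fin r) (b : Fin r → Fin L) : Fin r → Fin (L + 1) :=
  fun j => if j = i then (b j).succ else (b j).castSucc

lemma raise_injective {r L : ℕ} (i : Fin r) :
    Function.Injective (raise i : (Fin r → Fin L) → Fin r → Fin (L + 1)) := by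
  intro b c h
  funext j
  have hj := congrFun h j
  unfold raise at hj
  split_ifs at hj
  · exact Fin.succ_injective _ hj
  · exact Fin.castSucc_injective _ hj

/-- Coefficients of the product of a polynomial (given by its coefficients) with the `i`-th variable. -/
def shiftCoeff {r L D : ℕ} (i : Fin r) (f : (Fin r → Fin L) → Fin D) (a : Fin r → Fin (L + 1)) : ℕ :=
  ∑ b, if raise i b = a then (f b : ℕ) else 0

lemma shiftCoeff_lt {r L D : ℕ} (hD : 0 < D) (i : Fin r) (f : (Fin r → Fin L) → Fin D)
    (a : Fin r → Fin (L + 1)) : shiftCoeff i f a < D := by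
  unfold shiftCoeff
  by_cases h : ∃ b, raise i b = a
  · obtain ⟨b, rfl⟩ := h
    rw [Finset.sum_eq_single b]
    · rw [if_pos rfl]
      exact (f b).2
    · intro c _ hc
      rw [if_neg fun h => hc (raise_injective i h)]
    · simp
  · push Not at h
    simp [h, hD]

/-- The exponent of `D` at the monomial `b`, when the `j`-th variable is replaced by
`D ^ (L ^ (σ j))`. -/
def placeExp {r L N : ℕ} (σ : Equiv.Perm (Fin r)) (b : Fin r → Fin N) : ℕ :=
  ∑ j, (b j : ℕ) * L ^ (σ j : ℕ)

lemma placeExp_raise {r L : ℕ} (σ : Equiv.Perm (Fin r)) (i : Fin r) (b : Fin r → Fin L) :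
    placeExp (L := L) σ (raise i b) = placeExp (L := L) σ b + L ^ (σ i : ℕ) := by
  unfold placeExp
  have : ∀ j, ((raise i b j : Fin (L + 1)) : ℕ) * L ^ (σ j : ℕ) =
      (b j : ℕ) * L ^ (σ j : ℕ) + if j = i then L ^ (σ j : ℕ) else 0 := by
    intro j
    unfold raise
    split_ifs
    · simp [add_mul]
    · simp
  simp [this, Finset.sum_add_distrib]

/-- The value of a polynomial at the place where the `j`-th variable is `D ^ (L ^ (σ j))`. -/
def placeVal {r L D : ℕ} (σ : Equiv.Perm (Fin r)) (f : (Fin r → Fin L) → Fin D) : ℕ :=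
  ∑ b, (f b : ℕ) * D ^ placeExp (L := L) σ b

/-- The multi-exponents are enumerated by their exponents at a place. -/
def placeEquiv {r L : ℕ} (σ : Equiv.Perm (Fin r)) : (Fin r → Fin L) ≃ Fin (L ^ r) :=
  (Equiv.arrowCongr σ (Equiv.refl _)).trans finFunctionFinEquiv

lemma placeEquiv_apply {r L : ℕ} (σ : Equiv.Perm (Fin r)) (b : Fin r → Fin L) :
    (placeEquiv σ b : ℕ) = placeExp (L := L) σ b := by
  simp only [placeEquiv, Equiv.trans_apply, finFunctionFinEquiv_apply, placeExp]
  refine (Equiv.sum_comp σ _).symm.trans ?_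
  simp [Equiv.arrowCongr]

lemma placeVal_eq {r L D : ℕ} (σ : Equiv.Perm (Fin r)) (f : (Fin r → Fin L) → Fin D) :
    placeVal σ f = (finFunctionFinEquiv (f ∘ (placeEquiv σ).symm) : ℕ) := by
  rw [finFunctionFinEquiv_apply, placeVal, ← Equiv.sum_comp (placeEquiv σ)]
  simp [placeEquiv_apply]

lemma placeVal_lt {r L D : ℕ} (σ : Equiv.Perm (Fin r)) (f : (Fin r → Fin L) → Fin D) :
    placeVal σ f < D ^ L ^ r := by
  rw [placeVal_eq]
  exact Fin.is_lt _

/-- The coefficients are base-`D` digits, and their positions are the exponent vectors read as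
base-`L` numerals with digits permuted by `σ`. -/
lemma placeVal_injective {r L D : ℕ} (σ : Equiv.Perm (Fin r)) :
    Function.Injective (placeVal σ : ((Fin r → Fin L) → Fin D) → ℕ) := by
  intro f g h
  rw [placeVal_eq, placeVal_eq] at h
  have h1 := finFunctionFinEquiv.injective (Fin.ext h)
  funext b
  simpa using congrFun h1 (placeEquiv σ b)

lemma sum_shiftCoeff_mul {r L D : ℕ} (σ : Equiv.Perm (Fin r)) (i : Fin r)
    (f : (Fin r → Fin L) → Fin D) :
    ∑ a, shiftCoeff i f a * D ^ placeExp (L := L) σ a = D ^ L ^ (σ i : ℕ) * placeVal σ f := by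
  simp only [shiftCoeff, Finset.sum_mul, placeVal, Finset.mul_sum]
  rw [Finset.sum_comm]
  refine Finset.sum_congr rfl fun b _ => ?_
  simp only [ite_mul, zero_mul, Finset.sum_ite_eq, Finset.mem_univ, if_true, placeExp_raise, pow_add]
  ring

/-- The vertex of colour `i` on the edge `(x, m)`: the coefficients of `x + Yᵢ m`. -/
def edgeVertex {r L D d : ℕ} (hD : 0 < D) (i : Fin r)
    (p : (Fin d → (Fin r → Fin (L + 1)) → Fin D) × (Fin d → (Fin r → Fin L) → Fin D)) :
    Fin d → (Fin r → Fin (L + 1)) → Fin (2 * D) :=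
  fun k a => ⟨p.1 k a + shiftCoeff i (p.2 k) a, by
    have := shiftCoeff_lt hD i (p.2 k) a
    have := (p.1 k a).2
    omega⟩

/-- The sums of squares of the values of `m` at all places. -/
def squareSums {r L D d : ℕ} (m : Fin d → (Fin r → Fin L) → Fin D) (σ : Equiv.Perm (Fin r)) : ℕ :=
  ∑ k, placeVal σ (m k) ^ 2

variable {r L D d : ℕ}

lemma edgeVertex_place (hD : 0 < D) {i : Fin r}
    {p q : (Fin d → (Fin r → Fin (L + 1)) → Fin D) × (Fin d → (Fin r → Fin L) → Fin D)}
    (h : edgeVertex hD i p = edgeVertex hD i q) (σ : Equiv.Perm (Fin r)) (k : Fin d) :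
    ∑ a, (p.1 k a : ℕ) * D ^ placeExp (L := L) σ a + D ^ L ^ (σ i : ℕ) * placeVal σ (p.2 k) =
    ∑ a, (q.1 k a : ℕ) * D ^ placeExp (L := L) σ a + D ^ L ^ (σ i : ℕ) * placeVal σ (q.2 k) := by
  rw [← sum_shiftCoeff_mul, ← sum_shiftCoeff_mul, ← Finset.sum_add_distrib,
    ← Finset.sum_add_distrib]
  refine Finset.sum_congr rfl fun a _ => ?_
  have := congrArg Fin.val (congrFun (congrFun h k) a)
  simp only [edgeVertex] at this
  rw [← add_mul, ← add_mul, this]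

/-- One place determines `m`, whose exponents are below `L`. For `x` the exponent `L` occurs and
evaluation need not be injective, so `x` is recovered coefficientwise from the common vertex. -/
lemma eq_of_edgeVertex_eq (hD : 0 < D) {i : Fin r}
    {p q : (Fin d → (Fin r → Fin (L + 1)) → Fin D) × (Fin d → (Fin r → Fin L) → Fin D)}
    (h : edgeVertex hD i p = edgeVertex hD i q) (σ : Equiv.Perm (Fin r))
    (hm : ∀ k, placeVal σ (p.2 k) = placeVal σ (q.2 k)) : p = q := by
  have h2 : p.2 = q.2 := funext fun k => placeVal_injective σ (hm k)
  refine Prod.ext (funext fun k => funext fun a => Fin.ext ?_) h2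
  have := congrArg Fin.val (congrFun (congrFun h k) a)
  simp only [edgeVertex, h2] at this
  omega

lemma place_strictMono (hL : 2 ≤ L) (hD : 2 ≤ D) : StrictMono fun n : ℕ => ((D ^ L ^ n : ℕ) : ℤ) := by
  intro a b hab
  exact Nat.cast_lt.2 (Nat.pow_lt_pow_right hD (Nat.pow_lt_pow_right hL hab))

/-- The only solution of a convex relation between vectors of the same length is the trivial one. -/
lemma eq_of_convex_relation {u v w t : Fin d → ℤ} {R A B C E : ℤ} (hAB : A < B) (hBC : B ≤ C)
    (hCE : C ≤ E) (hu : ∑ k, u k ^ 2 = R) (hv : ∑ k, v k ^ 2 = R) (hw : ∑ k, w k ^ 2 = R)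
    (ht : ∑ k, t k ^ 2 = R)
    (hrel : ∀ k, (B - A) * v k + (C - B) * w k + (E - C) * t k = (E - A) * u k) : ∀ k, u k = v k := by
  -- Strict convexity of the sphere: the weighted squared distances from `u` sum to zero, and the
  -- weight `B - A` of `v` is positive.
  have h0 : ∑ k, ((B - A) * (v k - u k) ^ 2 + (C - B) * (w k - u k) ^ 2 +
      (E - C) * (t k - u k) ^ 2) = 0 := by
    have : ∀ k, (B - A) * (v k - u k) ^ 2 + (C - B) * (w k - u k) ^ 2 + (E - C) * (t k - u k) ^ 2 =
        (B - A) * v k ^ 2 + (C - B) * w k ^ 2 + (E - C) * t k ^ 2 - (E - A) * u k ^ 2 := by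
      intro k
      linear_combination (-2 * u k) * hrel k
    simp only [this, Finset.sum_add_distrib, Finset.sum_sub_distrib, ← Finset.mul_sum, hu, hv, hw, ht]
    ring
  have hB : 0 < B - A := by omega
  have hC : 0 ≤ C - B := by omega
  have hE : 0 ≤ E - C := by omega
  intro k
  have hk := (Finset.sum_eq_zero_iff_of_nonneg fun k _ => by positivity).1 h0 k (Finset.mem_univ k)
  have h1 : 0 ≤ (B - A) * (v k - u k) ^ 2 := by positivity
  have h2 : 0 ≤ (C - B) * (w k - u k) ^ 2 := by positivity
  have h3 : 0 ≤ (E - C) * (t k - u k) ^ 2 := by positivity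
  have h4 : (B - A) * (v k - u k) ^ 2 = 0 := by omega
  have h5 := (mul_eq_zero.1 h4).resolve_left hB.ne'
  have h6 := pow_eq_zero_iff (two_ne_zero) |>.1 h5
  omega

/-- A closed walk of length four whose colours increase at some place has a trivial step. -/
lemma eq_of_monotone_walk (hL : 2 ≤ L) (hD : 2 ≤ D) (hD' : 0 < D) {R : Equiv.Perm (Fin r) → ℕ}
    {p q s t : (Fin d → (Fin r → Fin (L + 1)) → Fin D) × (Fin d → (Fin r → Fin L) → Fin D)}
    (hp : squareSums p.2 = R) (hq : squareSums q.2 = R) (hs : squareSums s.2 = R)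
    (ht : squareSums t.2 = R) (σ : Equiv.Perm (Fin r)) {i j k l : Fin r} (hij : σ i < σ j)
    (hjk : σ j ≤ σ k) (hkl : σ k ≤ σ l) (h1 : edgeVertex hD' i p = edgeVertex hD' i q)
    (h2 : edgeVertex hD' j q = edgeVertex hD' j s) (h3 : edgeVertex hD' k s = edgeVertex hD' k t)
    (h4 : edgeVertex hD' l t = edgeVertex hD' l p) : p = q := by
  have hmono := place_strictMono hL hD
  have hsq : ∀ {m : Fin d → (Fin r → Fin L) → Fin D}, squareSums m = R →
      ∑ c, ((placeVal σ (m c) : ℕ) : ℤ) ^ 2 = (R σ : ℤ) := by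
    intro m hm
    rw [← hm, squareSums]
    push_cast
    rfl
  refine eq_of_edgeVertex_eq hD' h1 σ fun c => ?_
  -- The sum of the four incidence relations cancels every `x`; the coefficients left are the gaps
  -- between consecutive places.
  have := eq_of_convex_relation (u := fun c => (placeVal σ (p.2 c) : ℤ))
    (v := fun c => (placeVal σ (q.2 c) : ℤ)) (w := fun c => (placeVal σ (s.2 c) : ℤ))
    (t := fun c => (placeVal σ (t.2 c) : ℤ)) (hmono hij) (hmono.monotone hjk) (hmono.monotone hkl)
    (hsq hp) (hsq hq) (hsq hs) (hsq ht) (fun c => by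
      have e1 : ((_ : ℕ) : ℤ) = ((_ : ℕ) : ℤ) := congrArg Nat.cast (edgeVertex_place hD' h1 σ c)
      have e2 : ((_ : ℕ) : ℤ) = ((_ : ℕ) : ℤ) := congrArg Nat.cast (edgeVertex_place hD' h2 σ c)
      have e3 : ((_ : ℕ) : ℤ) = ((_ : ℕ) : ℤ) := congrArg Nat.cast (edgeVertex_place hD' h3 σ c)
      have e4 : ((_ : ℕ) : ℤ) = ((_ : ℕ) : ℤ) := congrArg Nat.cast (edgeVertex_place hD' h4 σ c)
      rw [Nat.cast_add, Nat.cast_add, Nat.cast_mul, Nat.cast_mul] at e1 e2 e3 e4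
      linear_combination e1 + e2 + e3 + e4) c
  exact_mod_cast this

/-- Provides the place at which the colours of a given rainbow cycle occur in increasing order. -/
lemma exists_perm_of_injective {n : ℕ} {f : Fin n → Fin r} (hf : Function.Injective f) :
    ∃ σ : Equiv.Perm (Fin r), ∀ a, ((σ (f a) : Fin r) : ℕ) = a := by
  have hn : n ≤ r := by simpa using Fintype.card_le_of_injective f hf
  obtain ⟨σ, hσ⟩ := (Equiv.Perm.isMultiplyPretransitive (Fin r) n).exists_smul_eq
    ⟨f, hf⟩ (Fin.castLEEmb hn)
  refine ⟨σ, fun a => ?_⟩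
  have := congrArg (fun g : Fin n ↪ Fin r => ((g a : Fin r) : ℕ)) hσ
  simpa using this

lemma isRainbowFree_edgeVertex (hL : 2 ≤ L) (hD : 2 ≤ D) (hD' : 0 < D)
    (R : Equiv.Perm (Fin r) → ℕ) :
    IsRainbowFree fun (i : Fin r) (p : {p : (Fin d → (Fin r → Fin (L + 1)) → Fin D) ×
      (Fin d → (Fin r → Fin L) → Fin D) // squareSums p.2 = R}) => edgeVertex hD' i p.1 := by
  constructor
  · intro i j p q hij h1 h2
    refine Subtype.ext (eq_of_edgeVertex_eq hD' h1 1 fun c => ?_)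
    have e1 : ((_ : ℕ) : ℤ) = ((_ : ℕ) : ℤ) := congrArg Nat.cast (edgeVertex_place hD' h1 1 c)
    have e2 : ((_ : ℕ) : ℤ) = ((_ : ℕ) : ℤ) := congrArg Nat.cast (edgeVertex_place hD' h2 1 c)
    rw [Nat.cast_add, Nat.cast_add, Nat.cast_mul, Nat.cast_mul] at e1 e2
    have hne : ((D ^ L ^ ((1 : Equiv.Perm (Fin r)) i : ℕ) : ℕ) : ℤ) -
        ((D ^ L ^ ((1 : Equiv.Perm (Fin r)) j : ℕ) : ℕ) : ℤ) ≠ 0 := by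
      rw [sub_ne_zero]
      intro he
      exact hij (Fin.ext ((place_strictMono hL hD).injective he))
    have h3 := mul_left_cancel₀ hne (b := ((placeVal 1 (p.1.2 c) : ℕ) : ℤ))
      (c := ((placeVal 1 (q.1.2 c) : ℕ) : ℤ)) (by linear_combination e1 - e2)
    exact_mod_cast h3
  · intro i j k p q s hij hjk hik h1 h2 h3
    obtain ⟨σ, hσ⟩ := exists_perm_of_injective (f := ![i, j, k]) (by
      intro a b hab
      fin_cases a <;> fin_cases b <;> simp_all)
    have e0 := hσ 0
    have e1 := hσ 1
    have e2 := hσ 2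
    simp only [Matrix.cons_val] at e0 e1 e2
    -- A triangle is a walk of length four whose last step stays at `p` in the colour `k`; this is
    -- why only the first colour inequality is strict.
    refine Subtype.ext (eq_of_monotone_walk hL hD hD' p.2 q.2 s.2 p.2 σ (i := i) (j := j) (k := k)
      (l := k) ?_ ?_ le_rfl h1 h2 h3 rfl)
    · rw [Fin.lt_def, e0, e1]; decide
    · rw [Fin.le_def, e1, e2]; decide
  · intro i j k l p q s t hij hik hil hjk hjl hkl h1 h2 h3 h4
    obtain ⟨σ, hσ⟩ := exists_perm_of_injective (f := ![i, j, k, l]) (by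
      intro a b hab
      fin_cases a <;> fin_cases b <;> simp_all)
    have e0 := hσ 0
    have e1 := hσ 1
    have e2 := hσ 2
    have e3 := hσ 3
    simp only [Matrix.cons_val] at e0 e1 e2 e3
    refine Subtype.ext (eq_of_monotone_walk hL hD hD' p.2 q.2 s.2 t.2 σ (i := i) (j := j) (k := k)
      (l := l) ?_ ?_ ?_ h1 h2 h3 h4)
    · rw [Fin.lt_def, e0, e1]; decide
    · rw [Fin.le_def, e1, e2]; decide
    · rw [Fin.le_def, e2, e3]; decide

/-- Some fibre of `squareSums` is large. -/
lemma exists_large_squareSums_fiber (hD : 0 < D) (hd : 0 < d) :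
    ∃ R : Equiv.Perm (Fin r) → ℕ, D ^ (d * L ^ r) ≤
      (d * D ^ (2 * L ^ r)) ^ r.factorial *
        (Finset.univ.filter fun m : Fin d → (Fin r → Fin L) → Fin D => squareSums m = R).card := by
  classical
  -- Pigeonhole: each of the `r!` entries of `squareSums m` is below `d * D ^ (2 * L ^ r)`.
  set T : Finset (Equiv.Perm (Fin r) → ℕ) :=
    Fintype.piFinset fun _ => Finset.range (d * D ^ (2 * L ^ r)) with hT
  have hTc : T.card = (d * D ^ (2 * L ^ r)) ^ r.factorial := by
    rw [hT, Fintype.card_piFinset]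
    simp [Fintype.card_perm]
  have hmaps : ∀ m ∈ (Finset.univ : Finset (Fin d → (Fin r → Fin L) → Fin D)), squareSums m ∈ T := by
    intro m _
    refine Fintype.mem_piFinset.2 fun σ => Finset.mem_range.2 ?_
    have hlt : ∀ k ∈ (Finset.univ : Finset (Fin d)), placeVal σ (m k) ^ 2 < D ^ (2 * L ^ r) := by
      intro k _
      rw [mul_comm, pow_mul]
      exact Nat.pow_lt_pow_left (placeVal_lt σ (m k)) two_ne_zero
    have : Nonempty (Fin d) := ⟨⟨0, hd⟩⟩
    calc squareSums m σ < ∑ _k : Fin d, D ^ (2 * L ^ r) :=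
          Finset.sum_lt_sum_of_nonempty Finset.univ_nonempty hlt
      _ = d * D ^ (2 * L ^ r) := by simp
  have hTne : T.Nonempty := by
    refine Finset.card_pos.1 ?_
    rw [hTc]
    positivity
  obtain ⟨R, hR, hmax⟩ := Finset.exists_max_image T
    (fun R => (Finset.univ.filter fun m : Fin d → (Fin r → Fin L) → Fin D => squareSums m = R).card)
    hTne
  refine ⟨R, ?_⟩
  have h1 := Finset.card_eq_sum_card_fiberwise hmaps
  have h2 := h1.trans_le (Finset.sum_le_card_nsmul _ _ _ hmax)
  rw [hTc, smul_eq_mul] at h2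
  refine le_of_eq_of_le ?_ h2
  simp [← pow_mul, mul_comm]

end ShiftConstruction

/-! ### From rainbow-free families to the bound on `brownErdosSos`, and the choice of parameters. -/

section LowerBound

lemma IsRainbowFree.card_le_brownErdosSos {r : ℕ} {P W : Type*} [Fintype P] [Fintype W]
    {π : Fin r → P → W} (h : IsRainbowFree π) (hr : 3 ≤ r) {e : ℕ}
    (he : e ∈ ({4, 5, 7, 8} : Finset ℕ)) {n : ℕ} (hn : r * Fintype.card W ≤ n) :
    Fintype.card P ≤ brownErdosSos r n (e * (r - 2) + 3) e := by
  classical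
  obtain ⟨φ⟩ : Nonempty (Fin r × W ↪ Fin n) :=
    Function.Embedding.nonempty_of_card_le (by simpa using hn)
  let edge : P → Finset (Fin n) := fun p => Finset.univ.image fun i => φ (i, π i p)
  have hmem : ∀ {i p q}, φ (i, π i p) ∈ edge q → π i p = π i q := by
    intro i p q hq
    obtain ⟨j, -, hj⟩ := Finset.mem_image.1 hq
    obtain ⟨rfl, h2⟩ := Prod.mk.inj (φ.injective hj)
    exact h2.symm
  have hself : ∀ i p, φ (i, π i p) ∈ edge p := fun i p =>
    Finset.mem_image_of_mem _ (Finset.mem_univ i)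
  have hinj : Function.Injective edge := by
    intro p q hpq
    have hall : ∀ i, π i p = π i q := fun i => hmem (hpq ▸ hself i p)
    exact h.linear (i := ⟨0, by omega⟩) (j := ⟨1, by omega⟩) (by simp) (hall _) (hall _)
  have hcard : (Finset.univ.image edge).card = Fintype.card P := by
    rw [Finset.card_image_of_injective _ hinj, Finset.card_univ]
  rw [← hcard, brownErdosSos]
  refine Finset.le_sup (f := Finset.card) (Finset.mem_filter.2 ⟨Finset.mem_univ _, ?_, ?_⟩)
  · intro A hA
    obtain ⟨p, -, rfl⟩ := Finset.mem_image.1 hA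
    rw [Finset.card_image_of_injective, Finset.card_univ, Fintype.card_fin]
    exact fun i j hij => (Prod.mk.inj (φ.injective hij)).1
  · intro S hS hSe
    set T : Finset P := Finset.univ.filter fun p => edge p ∈ S with hT
    have hTS : T.image edge = S := by
      ext A
      constructor
      · intro hA
        obtain ⟨p, hp, rfl⟩ := Finset.mem_image.1 hA
        exact (Finset.mem_filter.1 hp).2
      · intro hA
        obtain ⟨p, -, rfl⟩ := Finset.mem_image.1 (hS hA)
        exact Finset.mem_image_of_mem _ (Finset.mem_filter.2 ⟨Finset.mem_univ _, hA⟩)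
    have hTe : T.card = e := by
      rw [← hSe, ← hTS, Finset.card_image_of_injective _ hinj]
    have h1 := h.le_sum_card_image he hTe (by rw [Fintype.card_fin]; omega)
    rw [Fintype.card_fin, ← Finset.card_sigma] at h1
    refine le_trans ?_ (h1.trans (Finset.card_le_card_of_injOn (t := S.biUnion id)
      (fun a : (_ : Fin r) × W => φ (a.1, a.2)) ?_ ?_))
    · omega
    · rintro ⟨i, w⟩ ha
      obtain ⟨p, hp, hpw⟩ := Finset.mem_image.1 (Finset.mem_sigma.1 ha).2
      simp only at hpw
      subst hpw
      exact Finset.mem_biUnion.2 ⟨edge p, (Finset.mem_filter.1 hp).2, hself i p⟩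
    · rintro ⟨i, w⟩ - ⟨j, w'⟩ - hij
      obtain ⟨h2, h3⟩ := Prod.mk.inj (φ.injective hij)
      simp only at h2 h3
      subst h2 h3
      rfl

/-- The lower bound of the shift construction, with free parameters. -/
lemma pow_le_mul_brownErdosSos {r L D d n e : ℕ} (hr : 3 ≤ r) (he : e ∈ ({4, 5, 7, 8} : Finset ℕ))
    (hL : 2 ≤ L) (hD : 2 ≤ D) (hd : 0 < d) (hn : r * (2 * D) ^ (d * (L + 1) ^ r) ≤ n) :
    D ^ (d * (L + 1) ^ r + d * L ^ r) ≤
      (d * D ^ (2 * L ^ r)) ^ r.factorial * brownErdosSos r n (e * (r - 2) + 3) e := by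
  classical
  obtain ⟨R, hR⟩ := exists_large_squareSums_fiber (r := r) (L := L) (D := D) (d := d) (by omega) hd
  have h1 := (isRainbowFree_edgeVertex (d := d) hL hD (by omega) R).card_le_brownErdosSos hr he
    (n := n) (by simpa [← pow_mul, mul_comm] using hn)
  have h2 : Fintype.card {p : (Fin d → (Fin r → Fin (L + 1)) → Fin D) ×
      (Fin d → (Fin r → Fin L) → Fin D) // squareSums p.2 = R} = D ^ (d * (L + 1) ^ r) *
      (Finset.univ.filter fun m : Fin d → (Fin r → Fin L) → Fin D => squareSums m = R).card := by
    rw [Fintype.card_subtype]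
    have : (Finset.univ.filter fun p : (Fin d → (Fin r → Fin (L + 1)) → Fin D) ×
        (Fin d → (Fin r → Fin L) → Fin D) => squareSums p.2 = R) = Finset.univ ×ˢ
        (Finset.univ.filter fun m : Fin d → (Fin r → Fin L) → Fin D => squareSums m = R) := by
      ext p
      simp
    rw [this, Finset.card_product]
    simp [← pow_mul, mul_comm]
  rw [h2] at h1
  rw [pow_add]
  calc D ^ (d * (L + 1) ^ r) * D ^ (d * L ^ r) ≤ D ^ (d * (L + 1) ^ r) * _ :=
        Nat.mul_le_mul_left _ hR
    _ = (d * D ^ (2 * L ^ r)) ^ r.factorial * (D ^ (d * (L + 1) ^ r) * _) := by ring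
    _ ≤ _ := Nat.mul_le_mul_left _ h1

/-- The displayed product is the edge exponent minus one for `L = t` and `d = 2 * r! * t`. -/
lemma exists_parameter (r : ℕ) {ε : ℝ} (hε : 0 < ε) :
    ∃ t : ℕ, 2 ≤ t ∧ 1 - ε < ((t : ℝ) / (t + 1)) ^ r * (1 - 1 / (t : ℝ)) := by
  have h1 : Filter.Tendsto (fun t : ℕ => ((t : ℝ) / (t + 1)) ^ r * (1 - 1 / (t : ℝ)))
      Filter.atTop (nhds (1 ^ r * (1 - 0))) :=
    (tendsto_natCast_div_add_atTop (1 : ℝ)).pow r |>.mul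
      (tendsto_const_nhds.sub tendsto_one_div_atTop_nhds_zero_nat)
  rw [one_pow, one_mul, sub_zero] at h1
  obtain ⟨t, h2, h3⟩ := ((Filter.eventually_ge_atTop 2).and
    (h1.eventually (lt_mem_nhds (show 1 - ε < 1 by linarith)))).exists
  exact ⟨t, h2, h3⟩

open Filter in
lemma eventually_rpow_lt_brownErdosSos {r e : ℕ} (hr : 3 ≤ r)
    (he : e ∈ ({4, 5, 7, 8} : Finset ℕ)) {ε : ℝ} (hε : 0 < ε) :
    ∀ᶠ n : ℕ in atTop, (n : ℝ) ^ (2 - ε) < (brownErdosSos r n (e * (r - 2) + 3) e : ℝ) := by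
  obtain ⟨t, ht, hε'⟩ := exists_parameter r hε
  -- The spheres cost `2 * r! * t ^ r` in the exponent of `D`, a fraction `1 / t` of `d * t ^ r`.
  set d := 2 * r.factorial * t with hd
  have hd0 : 0 < d := by positivity
  set K := d * (t + 1) ^ r with hK
  have hK0 : 0 < K := by positivity
  -- the exponent of `D` in the lower bound
  set E := K + (d - 2 * r.factorial) * t ^ r with hE
  have hdle : 2 * r.factorial ≤ d := Nat.le_mul_of_pos_right _ (by omega)
  have hexp : K + d * t ^ r = 2 * t ^ r * r.factorial + E := by
    obtain ⟨c, hc⟩ := Nat.exists_eq_add_of_le hdle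
    rw [hE, hc, Nat.add_sub_cancel_left]
    ring
  have hEK : 2 - ε < (E : ℝ) / K := by
    have hKR : (0 : ℝ) < K := by exact_mod_cast hK0
    have htR : (0 : ℝ) < t := by exact_mod_cast (by omega : 0 < t)
    have hfR : (0 : ℝ) < r.factorial := by exact_mod_cast r.factorial_pos
    have : (E : ℝ) / K = 1 + ((t : ℝ) / (t + 1)) ^ r * (1 - 1 / (t : ℝ)) := by
      rw [hE, hK, Nat.cast_add, Nat.cast_mul (d - 2 * r.factorial), Nat.cast_sub hdle, hd, div_pow]
      push_cast
      field_simp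
    rw [this]
    linarith
  set α : ℝ := (E : ℝ) / K with hα
  have hr0 : (0 : ℝ) < r := by exact_mod_cast (by omega : 0 < r)
  have hKR : (0 : ℝ) < K := by exact_mod_cast hK0
  set c : ℝ := 1 / ((r : ℝ) ^ α * 4 ^ E * d ^ r.factorial) with hc
  have hdR : (0 : ℝ) < d := by exact_mod_cast hd0
  have hc0 : 0 < c := by positivity
  -- The bound 8 ensures `⌊y / 2⌋₊ ≥ y / 4 ≥ 2` below.
  have hbig : ∀ᶠ n : ℕ in atTop, 8 ≤ ((n : ℝ) / r) ^ ((1 : ℝ) / K) :=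
    ((tendsto_rpow_atTop (by positivity : (0 : ℝ) < 1 / K)).comp
      (tendsto_natCast_atTop_atTop.atTop_div_const hr0)).eventually_ge_atTop 8
  have hgrow : ∀ᶠ n : ℕ in atTop, 1 / c < (n : ℝ) ^ (α - (2 - ε)) :=
    ((tendsto_rpow_atTop (sub_pos.2 hEK)).comp
      tendsto_natCast_atTop_atTop).eventually_gt_atTop (1 / c)
  filter_upwards [hbig, hgrow, eventually_gt_atTop 0] with n hn1 hn2 hn0
  have hnR : (0 : ℝ) < n := by exact_mod_cast hn0
  set y : ℝ := ((n : ℝ) / r) ^ ((1 : ℝ) / K) with hy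
  set D := ⌊y / 2⌋₊ with hD
  have hDle : (D : ℝ) ≤ y / 2 := Nat.floor_le (by linarith)
  have hDge : y / 4 ≤ (D : ℝ) := by
    have := Nat.lt_floor_add_one (y / 2)
    rw [← hD] at this
    linarith
  have hD2 : 2 ≤ D := by
    have : (2 : ℝ) ≤ D := by linarith
    exact_mod_cast this
  have hyK : y ^ K = (n : ℝ) / r := by
    rw [hy, ← Real.rpow_natCast, ← Real.rpow_mul (by positivity)]
    rw [one_div_mul_cancel hKR.ne', Real.rpow_one]
  have hyE : y ^ E = ((n : ℝ) / r) ^ α := by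
    rw [hy, ← Real.rpow_natCast, ← Real.rpow_mul (by positivity), hα]
    congr 1
    ring
  have hsize : r * (2 * D) ^ K ≤ n := by
    have h1 : (2 * (D : ℝ)) ^ K ≤ y ^ K := pow_le_pow_left₀ (by positivity) (by linarith) K
    rw [hyK, le_div_iff₀ hr0] at h1
    have h2 : ((r * (2 * D) ^ K : ℕ) : ℝ) ≤ n := by
      push_cast
      linarith
    exact_mod_cast h2
  have hmain := pow_le_mul_brownErdosSos hr he ht hD2 hd0 hsize
  rw [← hK, hexp, pow_add, mul_pow, ← pow_mul] at hmain
  have hmain2 := Nat.le_of_mul_le_mul_left (hmain.trans_eq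
    (mul_right_comm _ _ _ |>.trans (mul_comm _ _))) (by positivity)
  have hmain3 : (D : ℝ) ^ E ≤ d ^ r.factorial * (brownErdosSos r n (e * (r - 2) + 3) e : ℝ) := by
    exact_mod_cast hmain2
  have h4 : (y / 4) ^ E ≤ (D : ℝ) ^ E := pow_le_pow_left₀ (by positivity) hDge E
  rw [div_pow, hyE, Real.div_rpow hnR.le hr0.le] at h4
  have h5 : c * (n : ℝ) ^ α ≤ (brownErdosSos r n (e * (r - 2) + 3) e : ℝ) := by
    have h6 := h4.trans hmain3
    rw [div_div, div_le_iff₀ (by positivity)] at h6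
    rw [hc, one_div_mul_eq_div, div_le_iff₀ (by positivity)]
    linarith
  refine lt_of_lt_of_le ?_ h5
  have h7 : (n : ℝ) ^ α = (n : ℝ) ^ (α - (2 - ε)) * (n : ℝ) ^ (2 - ε) := by
    rw [← Real.rpow_add hnR]
    congr 1
    ring
  have h8 : 1 < c * (n : ℝ) ^ (α - (2 - ε)) := by
    rw [div_lt_iff₀ hc0] at hn2
    linarith
  rw [h7, ← mul_assoc]
  exact lt_mul_of_one_lt_left (by positivity) h8

open Filter in
-- The exact deficit `a - log (f n) / log n` is bounded only from above by the hypothesis, hence the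
-- maximum with 0; the added `1 / (n + 1)` makes the inequality strict.
lemma exists_tendsto_zero_exponent {f : ℕ → ℕ} {a : ℝ}
    (h : ∀ ε : ℝ, 0 < ε → ∀ᶠ n : ℕ in atTop, (n : ℝ) ^ (a - ε) < f n) :
    ∃ δ : ℕ → ℝ, Tendsto δ atTop (nhds 0) ∧ ∀ᶠ n : ℕ in atTop, (n : ℝ) ^ (a - δ n) < f n := by
  have hfpos : ∀ {n : ℕ} {ε : ℝ}, (n : ℝ) ^ (a - ε) < f n → (0 : ℝ) < f n := fun hn =>
    lt_of_le_of_lt (by positivity) hn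
  have hinv : Tendsto (fun n : ℕ => 1 / ((n : ℝ) + 1)) atTop (nhds 0) :=
    tendsto_one_div_add_atTop_nhds_zero_nat
  have hmax : Tendsto (fun n : ℕ => max 0 (a - Real.log (f n) / Real.log n)) atTop (nhds 0) := by
    rw [Metric.tendsto_nhds]
    intro ε hε
    filter_upwards [h ε hε, eventually_ge_atTop 2] with n hn hn2
    have hn1 : (1 : ℝ) < n := by exact_mod_cast hn2
    have hlog : 0 < Real.log n := Real.log_pos hn1
    have h1 := Real.log_lt_log (by positivity) hn
    rw [Real.log_rpow (by linarith), ← lt_div_iff₀ hlog] at h1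
    rw [Real.dist_0_eq_abs, abs_of_nonneg (le_max_left _ _)]
    exact max_lt hε (by linarith)
  refine ⟨fun n => max 0 (a - Real.log (f n) / Real.log n) + 1 / ((n : ℝ) + 1), ?_, ?_⟩
  · simpa using hmax.add hinv
  · filter_upwards [h 1 one_pos, eventually_ge_atTop 2] with n hn hn2
    have hn1 : (1 : ℝ) < n := by exact_mod_cast hn2
    have hlog : 0 < Real.log n := Real.log_pos hn1
    have hf := hfpos hn
    have h2 : (n : ℝ) ^ (Real.log (f n) / Real.log n) = f n := by
      rw [Real.rpow_def_of_pos (by linarith), mul_div_cancel₀ _ hlog.ne', Real.exp_log hf]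
    rw [← h2]
    have hp : (0 : ℝ) < 1 / ((n : ℝ) + 1) := by positivity
    refine Real.rpow_lt_rpow_of_exponent_lt hn1 ?_
    have := le_max_right 0 (a - Real.log (f n) / Real.log n)
    rw [h2]
    linarith

end LowerBound

theorem theorem1p6 (r : ℕ) (hr : 3 ≤ r) (e : ℕ) (he : e ∈ ({4, 5, 7, 8} : Finset ℕ)) :
    ∃ δ : ℕ → ℝ, Filter.Tendsto δ Filter.atTop (nhds 0) ∧
      ∀ᶠ n : ℕ in Filter.atTop,
        (n : ℝ) ^ (2 - δ n) < (brownErdosSos r n (e * (r - 2) + 3) e : ℝ) :=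
  exists_tendsto_zero_exponent fun _ hε => eventually_rpow_lt_brownErdosSos hr he hε
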